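/- Let $X$ be a finite set with $\#X\ge 2$, let $F(X)$ be the free group on $X$, and let $w\in F(X)$. An \emph{elementary splitting} of $F(X)$ is an identification of $F(X)$ with the fundamental group of a connected graph of groups with exactly one edge and injective boundary maps. It is either a \emph{segment of groups}, that is, an amalgamated free product $G_1 *_C G_2$ with vertex groups $G_1,G_2$ and edge group $C$, or a \emph{loop of groups}, that is, an HNN extension $G*_C$ with vertex group $G$ and edge group $C$. It is \emph{nontrivial} if it is a loop of groups, or a segment of groups in which neither boundary map $C\to G_i$ is an isomorphism. The element $w$ is \emph{elliptic} in the splitting if $w$ is conjugate in $F(X)$ to an element of a vertex group. Suppose that $w$ is elliptic in some nontrivial elementary splitting of $F(X)$ whose edge group is either (1) trivial, or (2) infinite cyclic, where in the case of a segment of groups we also assume that neither of the two vertex groups is cyclic. Then the stabilizer $\{\alpha\in\operatorname{Aut}F(X) : \alpha(w)=w\}$ is not a cyclic group. -/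

import Mathlib

universe u v

/-- A segment of groups with fundamental group identified with `F`: a graph of groups with one edge
joining two distinct vertices (indexed by `Bool`). Its fundamental group is the amalgamated free
product of the two vertex groups over the edge group. -/
structure SegmentOfGroups (F : Type u) [Group F] where
  /-- the two vertex groups -/
  vert : Bool → Type v
  [vertGroup : ∀ i, Group (vert i)]
  /-- the edge group -/
  edge : Type v
  [edgeGroup : Group edge]
  /-- the two boundary maps -/
  bdry : ∀ i, edge →* vert i
  bdry_injective : ∀ i, Function.Injective (bdry i)
  /-- the identification of the fundamental group with `F` -/
  iso : Monoid.PushoutI bdry ≃* F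

attribute [instance] SegmentOfGroups.vertGroup SegmentOfGroups.edgeGroup

/-- A loop of groups with fundamental group identified with `F`: a graph of groups with one edge
and one vertex. Its fundamental group is the HNN extension of the vertex group in which the stable
letter conjugates the image of one boundary map to the image of the other. -/
structure LoopOfGroups (F : Type u) [Group F] where
  /-- the vertex group -/
  vert : Type v
  [vertGroup : Group vert]
  /-- the edge group -/
  edge : Type v
  [edgeGroup : Group edge]
  /-- the two boundary maps -/
  bdry : Bool → edge →* vert
  bdry_injective : ∀ i, Function.Injective (bdry i)
  /-- the identification of the fundamental group with `F` -/
  iso : HNNExtension vert (bdry false).range (bdry true).range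
    ((MonoidHom.ofInjective (bdry_injective false)).symm.trans
      (MonoidHom.ofInjective (bdry_injective true))) ≃* F

attribute [instance] LoopOfGroups.vertGroup LoopOfGroups.edgeGroup

/-- An elementary splitting of `F`: a decomposition of `F` as the fundamental group of a connected
graph of groups with exactly one edge. -/
inductive ElementarySplitting (F : Type u) [Group F] where
  | segment (S : SegmentOfGroups.{u, v} F)
  | loop (L : LoopOfGroups.{u, v} F)

namespace ElementarySplitting

variable {F : Type u} [Group F]

/-- The splitting is nontrivial: it is a loop of groups, or a segment of groups in which neither
boundary map is an isomorphism. -/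
def IsNontrivial : ElementarySplitting.{u, v} F → Prop
  | segment S => ∀ i, ¬ Function.Bijective (S.bdry i)
  | loop _ => True

/-- The edge group is trivial. -/
def IsOverTrivial : ElementarySplitting.{u, v} F → Prop
  | segment S => Subsingleton S.edge
  | loop L => Subsingleton L.edge

/-- The edge group is infinite cyclic. -/
def IsOverInfiniteCyclic : ElementarySplitting.{u, v} F → Prop
  | segment S => IsCyclic S.edge ∧ Infinite S.edge
  | loop L => IsCyclic L.edge ∧ Infinite L.edge

/-- If the splitting is a segment of groups, then neither of its vertex groups is cyclic
(no condition on loops of groups). -/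
def SegmentVerticesNoncyclic : ElementarySplitting.{u, v} F → Prop
  | segment S => ∀ i, ¬ IsCyclic (S.vert i)
  | loop _ => True

/-- The vertex groups of the splitting, as subgroups of `F`. -/
def vertexSubgroups : ElementarySplitting.{u, v} F → Set (Subgroup F)
  | segment S => Set.range fun i =>
      (S.iso.toMonoidHom.comp (Monoid.PushoutI.of (φ := S.bdry) i)).range
  | loop L => {(L.iso.toMonoidHom.comp HNNExtension.of).range}

/-- `w` is elliptic: it is conjugate in `F` to an element of a vertex group. -/
def IsElliptic (S : ElementarySplitting.{u, v} F) (w : F) : Prop :=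
  ∃ H ∈ S.vertexSubgroups, ∃ h ∈ H, IsConj w h

end ElementarySplitting

/-! The stabilizer of `w` contains conjugation by `w`. If it is cyclic, each nontrivial `α` in it
has a power equal to conjugation by some `w ^ j` with `j ≠ 0` (`exists_zpow_eq_conj`). Since the
free group is centerless and torsion-free, two kinds of `α` exclude this. If `α` is an involution,
`w ^ (2 * j)` is central, so `w = 1`. If `α` fixes pointwise a centerless vertex group containing
`w`, then `w ^ j` is central there, so again `w = 1`. But the stabilizer of `1` contains all inner
automorphisms and is not abelian.

Over a trivial edge group, inverting a basis of the other vertex group, or the stable letter, gives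
an involution. Over an infinite cyclic one, a Dehn twist fixes the vertex group. Vertex groups are
free, hence centerless once noncyclic; for loops, noncyclicity comes from
`FreeGroup.not_baumslagSolitar`. -/

/-! ### Centers and involutions of free groups -/

namespace FreeGroup

/-- The only element of a free group commuting with two distinct basis elements is `1`. -/
theorem eq_one_of_commute_of {X : Type u} {x y : X} (hxy : x ≠ y) {z : FreeGroup X}
    (hx : Commute z (of x)) (hy : Commute z (of y)) : z = 1 := by
  classical
  have key : ∀ a : X, Commute z (of a) → ∃ n : ℤ, z = of a ^ n := by
    intro a ha
    have hcomm : ∀ u ∈ ({z, of a} : Set (FreeGroup X)), ∀ v ∈ ({z, of a} : Set (FreeGroup X)),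
        u * v = v * u := by
      rintro u (rfl | rfl) v (rfl | rfl)
      exacts [rfl, ha, ha.symm, rfl]
    have hH := Subgroup.isMulCommutative_closure hcomm
    let H := Subgroup.closure ({z, of a} : Set (FreeGroup X))
    -- By Nielsen–Schreier `H` is free; being commutative, it has rank at most one.
    have hsub : Subsingleton (IsFreeGroup.Generators H) := by
      refine ⟨fun p q => ?_⟩
      by_contra hpq
      have h1 : (of p * of q : FreeGroup (IsFreeGroup.Generators H)) = of q * of p :=
        (IsFreeGroup.mulEquiv H).injective (by rw [_root_.map_mul, _root_.map_mul]; exact hH.is_comm.comm _ _)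
      have h2 := congrArg toWord h1
      simp [toWord_mul, FreeGroup.reduce, hpq] at h2
    have hcyc : IsCyclic H := by
      rcases isEmpty_or_nonempty (IsFreeGroup.Generators H) with h | ⟨⟨p⟩⟩
      · have : Subsingleton H := (IsFreeGroup.mulEquiv H).symm.injective.subsingleton
        infer_instance
      · have : Unique (IsFreeGroup.Generators H) := uniqueOfSubsingleton p
        exact isCyclic_of_surjective (IsFreeGroup.mulEquiv H) (IsFreeGroup.mulEquiv H).surjective
    obtain ⟨g, hg⟩ := hcyc.exists_generator
    obtain ⟨m, hm⟩ := Subgroup.mem_zpowers_iff.mp (hg ⟨z, Subgroup.subset_closure (by simp)⟩)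
    obtain ⟨k, hk⟩ := Subgroup.mem_zpowers_iff.mp (hg ⟨of a, Subgroup.subset_closure (by simp)⟩)
    have hm' : (g : FreeGroup X) ^ m = z := congrArg Subtype.val hm
    have hk' : (g : FreeGroup X) ^ k = of a := congrArg Subtype.val hk
    -- The exponent sum of `of a` is `1`, so `k` divides `1` and `g` is itself a power of `of a`.
    have h3 : k * Multiplicative.toAdd
        (lift (fun _ => Multiplicative.ofAdd (1 : ℤ)) (g : FreeGroup X)) = 1 := by
      have := congrArg (fun u => Multiplicative.toAdd
        (lift (fun _ => Multiplicative.ofAdd (1 : ℤ)) u)) hk'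
      simpa using this
    have hk2 : k * k = 1 := by
      rcases Int.isUnit_iff.mp (IsUnit.of_mul_eq_one _ h3) with rfl | rfl <;> rfl
    refine ⟨k * m, ?_⟩
    rw [← hk', ← zpow_mul, ← mul_assoc, hk2, one_mul, hm']
  obtain ⟨m, hm⟩ := key x hx
  obtain ⟨n, hn⟩ := key y hy
  have h := congrArg (fun u => Multiplicative.toAdd
    (lift (fun a => if a = x then Multiplicative.ofAdd (1 : ℤ) else 1) u)) (hm.symm.trans hn)
  have hm0 : m = 0 := by simpa [hxy.symm] using h
  simpa [hm0] using hm

theorem eq_one_of_forall_commute {X : Type u} [Nontrivial X] {z : FreeGroup X}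
    (hz : ∀ x, Commute z x) : z = 1 := by
  obtain ⟨x, y, hxy⟩ := exists_pair_ne X
  exact eq_one_of_commute_of hxy (hz _) (hz _)

end FreeGroup

namespace IsFreeGroup

variable {G : Type u} [Group G] [IsFreeGroup G]

instance isMulTorsionFree : IsMulTorsionFree G :=
  Function.Injective.isMulTorsionFree (mulEquiv G).symm.toMonoidHom (mulEquiv G).symm.injective

theorem nontrivial_generators (h : ¬ IsCyclic G) : Nontrivial (Generators G) := by
  by_contra hn
  rw [not_nontrivial_iff_subsingleton] at hn
  apply h
  rcases isEmpty_or_nonempty (Generators G) with _ | ⟨⟨p⟩⟩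
  · have : Subsingleton G := (mulEquiv G).symm.injective.subsingleton
    infer_instance
  · have : Unique (Generators G) := uniqueOfSubsingleton p
    exact isCyclic_of_surjective (mulEquiv G) (mulEquiv G).surjective

theorem eq_one_of_forall_commute (h : ¬ IsCyclic G) {z : G} (hz : ∀ x, Commute z x) : z = 1 := by
  have := nontrivial_generators h
  have h1 : (mulEquiv G).symm z = 1 := FreeGroup.eq_one_of_forall_commute fun x => by
    simpa using (hz (mulEquiv G x)).map (mulEquiv G).symm
  simpa using h1

/-- A nontrivial free group has an automorphism of order two, inverting all basis elements. -/
theorem exists_mulAut_involution [Nontrivial G] : ∃ σ : MulAut G, σ ≠ 1 ∧ σ * σ = 1 := by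
  classical
  let f : FreeGroup (Generators G) →* FreeGroup (Generators G) :=
    FreeGroup.lift fun x => (FreeGroup.of x)⁻¹
  have hf : f.comp f = MonoidHom.id _ := by ext x; simp [f]
  let σ : MulAut (FreeGroup (Generators G)) := f.toMulEquiv f hf hf
  have hσ : ∀ x, σ (σ x) = x := fun x => DFunLike.congr_fun hf x
  refine ⟨(mulEquiv G).symm.trans (σ.trans (mulEquiv G)), fun h => ?_, ?_⟩
  · have : Nonempty (Generators G) := by
      by_contra he
      rw [not_nonempty_iff] at he
      exact not_subsingleton G (mulEquiv G).symm.injective.subsingleton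
    obtain ⟨x⟩ := this
    have h1 : mulEquiv G (σ (FreeGroup.of x)) = mulEquiv G (FreeGroup.of x) := by
      simpa using DFunLike.congr_fun h (mulEquiv G (FreeGroup.of x))
    have h2 : (FreeGroup.of x)⁻¹ = FreeGroup.of x := by
      simpa [σ, f] using (mulEquiv G).injective h1
    have h3 := congrArg FreeGroup.toWord h2
    simp [FreeGroup.toWord_inv, FreeGroup.invRev] at h3
  · ext x
    simp [MulAut.mul_apply, hσ]

end IsFreeGroup

/-! ### Obstructions to a cyclic stabilizer -/

section Stabilizer

variable {F : Type u} [Group F]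

open MulAction

theorem not_isCyclic_stabilizer_one (hF : ∀ z : F, (∀ x, Commute z x) → z = 1) [Nontrivial F] :
    ¬ IsCyclic (stabilizer (MulAut F) (1 : F)) := by
  intro h
  obtain ⟨a, ha⟩ := exists_ne (1 : F)
  refine ha (hF a fun b => ?_)
  have mem : ∀ x : F, MulAut.conj x ∈ stabilizer (MulAut F) (1 : F) := fun x => by
    simp [mem_stabilizer_iff]
  have hab : MulAut.conj (a * b) = MulAut.conj (b * a) := by
    have := congrArg Subtype.val
      (h.isMulCommutative.is_comm.comm (⟨_, mem a⟩ : stabilizer (MulAut F) (1 : F)) ⟨_, mem b⟩)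
    simpa using this
  have h1 : (b * a)⁻¹ * (a * b) = 1 := hF _ fun x => by
    have := DFunLike.congr_fun hab x
    simp only [MulAut.conj_apply] at this
    have h2 : (b * a)⁻¹ * (a * b) * x = (b * a)⁻¹ * ((a * b) * x * (a * b)⁻¹) * (a * b) := by group
    rw [Commute, SemiconjBy, h2, this]
    group
  exact (inv_mul_eq_one.mp h1).symm

/-- In a cyclic stabilizer of `w`, every element has a power that is conjugation by a nontrivial
power of `w`. -/
theorem exists_zpow_eq_conj {w : F}
    (h : IsCyclic (stabilizer (MulAut F) w)) {α : MulAut F} (hα : α w = w) (hα1 : α ≠ 1) :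
    ∃ i j : ℤ, j ≠ 0 ∧ α ^ i = MulAut.conj (w ^ j) := by
  obtain ⟨g, hg⟩ := h.exists_generator
  have hw : MulAut.conj w ∈ stabilizer (MulAut F) w := by
    simp [mem_stabilizer_iff, MulAut.smul_def]
  obtain ⟨i, hi⟩ := Subgroup.mem_zpowers_iff.mp (hg ⟨_, hw⟩)
  obtain ⟨j, hj⟩ := Subgroup.mem_zpowers_iff.mp (hg ⟨α, hα⟩)
  have hi' : (g : MulAut F) ^ i = MulAut.conj w := congrArg Subtype.val hi
  have hj' : (g : MulAut F) ^ j = α := congrArg Subtype.val hj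
  refine ⟨i, j, ?_, ?_⟩
  · rintro rfl
    exact hα1 (by simpa using hj'.symm)
  · rw [map_zpow, ← hi', ← hj', ← zpow_mul, ← zpow_mul, mul_comm]

theorem not_isCyclic_stabilizer_of_involution [IsMulTorsionFree F] [Nontrivial F]
    (hF : ∀ z : F, (∀ x, Commute z x) → z = 1) {w : F} {α : MulAut F} (hα : α w = w)
    (hα1 : α ≠ 1) (hα2 : α * α = 1) : ¬ IsCyclic (stabilizer (MulAut F) w) := by
  intro h
  obtain ⟨i, j, hj, hij⟩ := exists_zpow_eq_conj h hα hα1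
  have h1 : MulAut.conj (w ^ (j + j)) = 1 := by
    rw [zpow_add, map_mul, ← hij, ← (Commute.refl α).mul_zpow, hα2, one_zpow]
  have h2 : w ^ (j + j) = 1 := hF _ fun x => by
    have := DFunLike.congr_fun h1 x
    rw [MulAut.conj_apply] at this
    exact mul_inv_eq_iff_eq_mul.mp this
  have hw : w = 1 := (IsMulTorsionFree.zpow_eq_one_iff_left (by omega)).mp h2
  subst hw
  exact not_isCyclic_stabilizer_one hF h

theorem not_isCyclic_stabilizer_of_fixes [IsMulTorsionFree F] [Nontrivial F]
    (hF : ∀ z : F, (∀ x, Commute z x) → z = 1) {G : Type v} [Group G] {f : G →* F}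
    (hf : Function.Injective f) (hG : ∀ z : G, (∀ x, Commute z x) → z = 1) {g : G}
    {α : MulAut F} (hα : ∀ x, α (f x) = f x) (hα1 : α ≠ 1) :
    ¬ IsCyclic (stabilizer (MulAut F) (f g)) := by
  intro h
  obtain ⟨i, j, hj, hij⟩ := exists_zpow_eq_conj h (hα g) hα1
  have h2 : g ^ j = 1 := hG _ fun x => by
    have hx : α ^ i ∈ stabilizer (MulAut F) (f x) := Subgroup.zpow_mem _ (hα x) i
    rw [hij, mem_stabilizer_iff, MulAut.smul_def, MulAut.conj_apply, mul_inv_eq_iff_eq_mul,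
      ← map_zpow, ← map_mul, ← map_mul] at hx
    exact hf hx
  have hw : f g = 1 := (IsMulTorsionFree.zpow_eq_one_iff_left hj).mp (by rw [← map_zpow, h2, map_one])
  rw [hw] at h
  exact not_isCyclic_stabilizer_one hF h

end Stabilizer

/-! ### Automorphisms adapted to a splitting -/

namespace SegmentOfGroups

variable {F : Type u} [Group F] (S : SegmentOfGroups.{u, v} F)

/-- The inclusion of a vertex group in the fundamental group. -/
def incl (i : Bool) : S.vert i →* F :=
  S.iso.toMonoidHom.comp (Monoid.PushoutI.of (φ := S.bdry) i)

theorem incl_injective (i : Bool) : Function.Injective (S.incl i) :=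
  S.iso.injective.comp (Monoid.PushoutI.of_injective S.bdry_injective i)

theorem hom_ext {K : Type*} [Monoid K] {f g : F →* K}
    (h : ∀ i x, f (S.incl i x) = g (S.incl i x)) : f = g := by
  have : f.comp S.iso.toMonoidHom = g.comp S.iso.toMonoidHom :=
    Monoid.PushoutI.hom_ext_nonempty fun i => MonoidHom.ext (h i)
  ext x
  simpa using DFunLike.congr_fun this (S.iso.symm x)

theorem exists_hom (β : ∀ i, MulAut (S.vert i)) (hβ : ∀ i c, β i (S.bdry i c) = S.bdry i c) :
    ∃ φ : F →* F, ∀ i x, φ (S.incl i x) = S.incl i (β i x) := by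
  refine ⟨(Monoid.PushoutI.lift (fun i => (S.incl i).comp (β i).toMonoidHom)
    (S.iso.toMonoidHom.comp (Monoid.PushoutI.base S.bdry)) fun i => ?_).comp
      S.iso.symm.toMonoidHom, fun i x => ?_⟩
  · ext c
    simp [incl, hβ, Monoid.PushoutI.of_apply_eq_base]
  · simp [incl]

/-- Automorphisms of the vertex groups fixing the edge group pointwise extend. -/
theorem exists_mulAut (β : ∀ i, MulAut (S.vert i)) (hβ : ∀ i c, β i (S.bdry i c) = S.bdry i c) :
    ∃ α : MulAut F, ∀ i x, α (S.incl i x) = S.incl i (β i x) := by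
  obtain ⟨φ, hφ⟩ := S.exists_hom β hβ
  obtain ⟨ψ, hψ⟩ := S.exists_hom (fun i => (β i)⁻¹) fun i c => by
    rw [MulAut.inv_apply, MulEquiv.symm_apply_eq, hβ]
  refine ⟨φ.toMulEquiv ψ (S.hom_ext fun i x => ?_) (S.hom_ext fun i x => ?_), hφ⟩
  · simp [hφ, hψ]
  · simp [hφ, hψ]

/-- An automorphism of one vertex group fixing the edge group pointwise extends by the identity
of the other vertex group. -/
theorem exists_mulAut_single (i : Bool) (β : MulAut (S.vert i))
    (hβ : ∀ c, β (S.bdry i c) = S.bdry i c) :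
    ∃ α : MulAut F, (∀ x, α (S.incl i x) = S.incl i (β x)) ∧
      ∀ j ≠ i, ∀ x, α (S.incl j x) = S.incl j x := by
  obtain ⟨α, hα⟩ := S.exists_mulAut (Function.update 1 i β) fun j c => by
    rcases eq_or_ne j i with rfl | hj
    · simpa using hβ c
    · simp [hj]
  exact ⟨α, fun x => by simp [hα], fun j hj x => by simp [hα, hj]⟩

end SegmentOfGroups

namespace LoopOfGroups

variable {F : Type u} [Group F] (L : LoopOfGroups.{u, v} F)

/-- The inclusion of the vertex group in the fundamental group. -/
noncomputable def incl : L.vert →* F := L.iso.toMonoidHom.comp HNNExtension.of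

/-- The stable letter. -/
noncomputable def stable : F := L.iso HNNExtension.t

theorem incl_injective : Function.Injective L.incl :=
  L.iso.injective.comp (HNNExtension.of_injective _)

theorem stable_mul_incl (c : L.edge) :
    L.stable * L.incl (L.bdry false c) = L.incl (L.bdry true c) * L.stable := by
  have h := congrArg L.iso (HNNExtension.t_mul_of (φ :=
    (MonoidHom.ofInjective (L.bdry_injective false)).symm.trans
      (MonoidHom.ofInjective (L.bdry_injective true)))
    (MonoidHom.ofInjective (L.bdry_injective false) c))
  simp only [map_mul, MulEquiv.trans_apply, MulEquiv.symm_apply_apply,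
    MonoidHom.ofInjective_apply] at h
  exact h

theorem hom_ext {K : Type*} [Monoid K] {f g : F →* K} (h : ∀ x, f (L.incl x) = g (L.incl x))
    (ht : f L.stable = g L.stable) : f = g := by
  have : f.comp L.iso.toMonoidHom = g.comp L.iso.toMonoidHom :=
    HNNExtension.hom_ext (MonoidHom.ext h) ht
  ext x
  simpa using DFunLike.congr_fun this (L.iso.symm x)

theorem exists_hom {K : Type*} [Group K] (f : L.vert →* K) (s : K)
    (hs : ∀ c, s * f (L.bdry false c) = f (L.bdry true c) * s) :
    ∃ φ : F →* K, (∀ x, φ (L.incl x) = f x) ∧ φ L.stable = s := by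
  refine ⟨(HNNExtension.lift f s ?_).comp L.iso.symm.toMonoidHom, fun x => ?_, ?_⟩
  · intro a
    obtain ⟨c, rfl⟩ := (MonoidHom.ofInjective (L.bdry_injective false)).surjective a
    simpa only [MulEquiv.trans_apply, MulEquiv.symm_apply_apply,
      MonoidHom.ofInjective_apply] using hs c
  · simp [incl]
  · simp [stable]

theorem exists_stable_eq : ∃ φ : F →* Multiplicative ℤ, φ L.stable = Multiplicative.ofAdd 1 := by
  obtain ⟨φ, -, h⟩ := L.exists_hom (1 : L.vert →* Multiplicative ℤ) (Multiplicative.ofAdd 1)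
    (by simp)
  exact ⟨φ, h⟩

/-- Inverting the stable letter, when the edge group is trivial. -/
theorem exists_involution (h : Subsingleton L.edge) :
    ∃ α : MulAut F, (∀ x, α (L.incl x) = L.incl x) ∧ α ≠ 1 ∧ α * α = 1 := by
  obtain ⟨φ, hφ, hφt⟩ := L.exists_hom L.incl L.stable⁻¹ fun c => by
    rw [Subsingleton.elim c 1]; simp
  have h2 : φ.comp φ = MonoidHom.id F := L.hom_ext (by simp [hφ]) (by simp [hφt])
  refine ⟨φ.toMulEquiv φ h2 h2, hφ, fun h1 => ?_, MulEquiv.ext fun x => DFunLike.congr_fun h2 x⟩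
  have h3 : L.stable⁻¹ = L.stable := hφt.symm.trans (DFunLike.congr_fun h1 L.stable)
  obtain ⟨ψ, hψ⟩ := L.exists_stable_eq
  have h4 := congrArg (fun x => Multiplicative.toAdd (ψ x)) h3
  simp [hψ] at h4

/-- The Dehn twist multiplying the stable letter by an element of a commutative edge group. -/
theorem exists_twist (c : L.edge) (hc : ∀ d, Commute c d) (hc1 : c ≠ 1) :
    ∃ α : MulAut F, (∀ x, α (L.incl x) = L.incl x) ∧ α ≠ 1 := by
  have key : ∀ e : L.edge, (∀ d, Commute e d) → ∃ φ : F →* F, (∀ x, φ (L.incl x) = L.incl x) ∧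
      φ L.stable = L.stable * L.incl (L.bdry false e) := fun e he =>
    -- The HNN relation survives because `e` commutes with the edge group.
    L.exists_hom L.incl _ fun d => by
      rw [mul_assoc, ← map_mul, ← map_mul, (he d).eq, map_mul, map_mul, ← mul_assoc,
        L.stable_mul_incl, mul_assoc]
  obtain ⟨φ, hφ, hφt⟩ := key c hc
  obtain ⟨ψ, hψ, hψt⟩ := key c⁻¹ fun d => (hc d).inv_left
  refine ⟨φ.toMulEquiv ψ (L.hom_ext (by simp [hφ, hψ]) (by simp [hψ, hφt, hψt]))
    (L.hom_ext (by simp [hφ, hψ]) (by simp [hφ, hφt, hψt])), hφ, fun h1 => ?_⟩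
  have h3 : L.stable * L.incl (L.bdry false c) = L.stable :=
    hφt.symm.trans (DFunLike.congr_fun h1 L.stable)
  refine hc1 (L.bdry_injective false (L.incl_injective ?_))
  simpa using h3

end LoopOfGroups

/-! ### Loops have noncyclic vertex group -/

/-- A free group of finite rank at least two is not generated by two elements `s`, `g` with
`s * g ^ p = g ^ q * s`, where `p ≠ 0`. -/
theorem FreeGroup.not_baumslagSolitar {X : Type u} [Finite X] [Nontrivial X]
    {s g : FreeGroup X} {p q : ℤ} (hp : p ≠ 0) (hr : s * g ^ p = g ^ q * s)
    (hgen : ∀ {K : Type} [Group K] (f f' : FreeGroup X →* K), f s = f' s → f g = f' g → f = f') :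
    False := by
  -- This `N` exceeds `|2 * p|`, so `N ∣ 2 * p` would force `p = 0`.
  obtain ⟨N, hN⟩ : ∃ N : ℕ, N = (2 * p).natAbs + 1 := ⟨_, rfl⟩
  have : NeZero N := ⟨by omega⟩
  let ev : (X → DihedralGroup N) → DihedralGroup N × DihedralGroup N := fun u => (FreeGroup.lift u s, FreeGroup.lift u g)
  -- Counting homomorphisms to a finite group `D`: there are `|D| ^ |X| ≥ |D| ^ 2`, each determined
  -- by its values on `s` and `g`. Hence every pair in `D` occurs and satisfies the relation.
  have hinj : Function.Injective ev := fun u u' h =>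
    FreeGroup.lift.injective (hgen _ _ (congrArg Prod.fst h) (congrArg Prod.snd h))
  have hcard : Nat.card (DihedralGroup N × DihedralGroup N) ≤ Nat.card (X → DihedralGroup N) := by
    rw [Nat.card_prod, Nat.card_fun, ← sq]
    exact Nat.pow_le_pow_right Nat.card_pos (Finite.one_lt_card_iff_nontrivial.mpr inferInstance)
  have hsurj := (Function.Injective.bijective_of_nat_card_le hinj hcard).surjective
  have hrel : ∀ a b : DihedralGroup N, a * b ^ p = b ^ q * a := by
    intro a b
    obtain ⟨u, hu⟩ := hsurj (a, b)
    obtain ⟨rfl, rfl⟩ := Prod.mk.inj hu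
    simpa using congrArg (FreeGroup.lift u) hr
  -- Modulo `N`, the identity gives `p = q` and a reflection gives `p = -q`.
  have h1 := hrel 1 (DihedralGroup.r 1)
  have h2 := hrel (DihedralGroup.sr 0) (DihedralGroup.r 1)
  simp only [DihedralGroup.r_one_zpow, one_mul, mul_one, DihedralGroup.r.injEq, DihedralGroup.sr_mul_r,
    DihedralGroup.r_mul_sr, DihedralGroup.sr.injEq] at h1 h2
  have h4 : ((2 * p : ℤ) : ZMod N) = 0 := by
    push_cast
    linear_combination h1 + h2
  rw [ZMod.intCast_zmod_eq_zero_iff_dvd] at h4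
  have h6 := Int.eq_zero_of_abs_lt_dvd h4 (by rw [Int.abs_eq_natAbs]; omega)
  omega

theorem LoopOfGroups.not_isCyclic_vert {X : Type u} [Finite X] [Nontrivial X]
    (L : LoopOfGroups.{u, v} (FreeGroup X)) [Nontrivial L.edge] : ¬ IsCyclic L.vert := by
  intro h
  obtain ⟨g, hg⟩ := h.exists_generator
  obtain ⟨c, hc⟩ := exists_ne (1 : L.edge)
  obtain ⟨p, hp⟩ := Subgroup.mem_zpowers_iff.mp (hg (L.bdry false c))
  obtain ⟨q, hq⟩ := Subgroup.mem_zpowers_iff.mp (hg (L.bdry true c))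
  refine FreeGroup.not_baumslagSolitar (s := L.stable) (g := L.incl g) (p := p) (q := q) ?_ ?_ ?_
  · rintro rfl
    exact hc (L.bdry_injective false (by simpa using hp.symm))
  · rw [← map_zpow, ← map_zpow, hp, hq, L.stable_mul_incl]
  · intro K _ f f' hs hfg
    refine L.hom_ext (fun x => ?_) hs
    obtain ⟨n, rfl⟩ := Subgroup.mem_zpowers_iff.mp (hg x)
    rw [map_zpow, map_zpow, map_zpow, hfg]

/-! ### The two kinds of splitting, and the conclusion -/

theorem IsFreeGroup.of_injective {F : Type u} [Group F] [IsFreeGroup F] {G : Type v} [Group G]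
    {f : G →* F} (hf : Function.Injective f) : IsFreeGroup G :=
  IsFreeGroup.ofMulEquiv (MonoidHom.ofInjective hf).symm

theorem SegmentOfGroups.not_isCyclic_stabilizer {X : Type u} [Nontrivial X]
    (S : SegmentOfGroups.{u, v} (FreeGroup X)) (hS : ∀ i, ¬ Function.Bijective (S.bdry i))
    (hedge : Subsingleton S.edge ∨
      ((IsCyclic S.edge ∧ Infinite S.edge) ∧ ∀ i, ¬ IsCyclic (S.vert i)))
    (i : Bool) (g : S.vert i) :
    ¬ IsCyclic (MulAction.stabilizer (MulAut (FreeGroup X)) (S.incl i g)) := by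
  have hF : ∀ z : FreeGroup X, (∀ x, Commute z x) → z = 1 := fun _ =>
    FreeGroup.eq_one_of_forall_commute
  have hfree : ∀ j, IsFreeGroup (S.vert j) := fun j => IsFreeGroup.of_injective (S.incl_injective j)
  have hne : i ≠ !i := by cases i <;> decide
  rcases hedge with h | ⟨⟨hcyc, hinf⟩, hv⟩
  · have : Nontrivial (S.vert !i) := by
      by_contra hn
      rw [not_nontrivial_iff_subsingleton] at hn
      exact hS (!i) ⟨S.bdry_injective _, fun x => ⟨1, Subsingleton.elim _ _⟩⟩
    obtain ⟨σ, hσ1, hσ2⟩ := IsFreeGroup.exists_mulAut_involution (G := S.vert !i)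
    obtain ⟨α, hα, hα'⟩ := S.exists_mulAut_single (!i) σ fun c => by
      rw [Subsingleton.elim c 1]; simp
    refine not_isCyclic_stabilizer_of_involution hF (hα' i hne g) (fun h1 => hσ1 ?_) ?_
    · ext x
      refine S.incl_injective (!i) ?_
      rw [← hα, h1]
      rfl
    · have : (α * α).toMonoidHom = MonoidHom.id _ := S.hom_ext fun j x => by
        rcases eq_or_ne j (!i) with rfl | hj
        · have := DFunLike.congr_fun hσ2 x
          rw [MulAut.mul_apply, MulAut.one_apply] at this
          simp [hα, this]
        · simp [hα' j hj]
      exact MulEquiv.ext fun x => DFunLike.congr_fun this x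
  · obtain ⟨c, hc⟩ := exists_ne (1 : S.edge)
    -- Dehn twist: conjugate only the vertex group not containing `g`. It is nontrivial because that
    -- group is centerless.
    obtain ⟨α, hα, hα'⟩ := S.exists_mulAut_single (!i) (MulAut.conj (S.bdry (!i) c)) fun d => by
      rw [MulAut.conj_apply, ← map_mul, hcyc.isMulCommutative.is_comm.comm c d, map_mul, mul_inv_cancel_right]
    refine not_isCyclic_stabilizer_of_fixes hF (S.incl_injective i)
      (fun _ => IsFreeGroup.eq_one_of_forall_commute (hv i)) (hα' i hne) fun h1 => ?_
    refine hc (S.bdry_injective (!i) ?_)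
    rw [map_one]
    refine IsFreeGroup.eq_one_of_forall_commute (hv !i) fun x => ?_
    have h2 := hα x
    rw [h1, MulAut.one_apply] at h2
    exact mul_inv_eq_iff_eq_mul.mp (S.incl_injective _ h2).symm

theorem LoopOfGroups.not_isCyclic_stabilizer {X : Type u} [Finite X] [Nontrivial X]
    (L : LoopOfGroups.{u, v} (FreeGroup X))
    (hedge : Subsingleton L.edge ∨ (IsCyclic L.edge ∧ Infinite L.edge)) (g : L.vert) :
    ¬ IsCyclic (MulAction.stabilizer (MulAut (FreeGroup X)) (L.incl g)) := by
  have hF : ∀ z : FreeGroup X, (∀ x, Commute z x) → z = 1 := fun _ =>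
    FreeGroup.eq_one_of_forall_commute
  have hfree : IsFreeGroup L.vert := IsFreeGroup.of_injective L.incl_injective
  rcases hedge with h | ⟨hcyc, hinf⟩
  · obtain ⟨α, hα, hα1, hα2⟩ := L.exists_involution h
    exact not_isCyclic_stabilizer_of_involution hF (hα g) hα1 hα2
  · obtain ⟨c, hc⟩ := exists_ne (1 : L.edge)
    obtain ⟨α, hα, hα1⟩ := L.exists_twist c (fun d => hcyc.isMulCommutative.is_comm.comm c d) hc
    exact not_isCyclic_stabilizer_of_fixes hF L.incl_injective
      (fun _ => IsFreeGroup.eq_one_of_forall_commute L.not_isCyclic_vert) hα hα1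

theorem mainTheorem2 {X : Type u} [Finite X] [Nontrivial X] (w : FreeGroup X)
    (hw : ∃ S : ElementarySplitting.{u, v} (FreeGroup X), S.IsNontrivial ∧
      (S.IsOverTrivial ∨ (S.IsOverInfiniteCyclic ∧ S.SegmentVerticesNoncyclic)) ∧
      S.IsElliptic w) :
    ¬ IsCyclic (MulAction.stabilizer (MulAut (FreeGroup X)) w) := by
  obtain ⟨S, hS, hedge, H, hH, h, hhH, hconj⟩ := hw
  suffices hs : ¬ IsCyclic (MulAction.stabilizer (MulAut (FreeGroup X)) h) by
    intro hcyc
    obtain ⟨k, hk⟩ := isConj_iff.mp hconj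
    let e := MulAction.stabilizerEquivStabilizer (G := MulAut (FreeGroup X)) (a := w) (b := h)
      (g := MulAut.conj k) (by rw [MulAut.smul_def, MulAut.conj_apply, hk])
    exact hs (isCyclic_of_surjective e e.surjective)
  cases S with
  | segment S =>
    obtain ⟨i, rfl⟩ := hH
    obtain ⟨g, rfl⟩ := hhH
    exact S.not_isCyclic_stabilizer hS hedge i g
  | loop L =>
    obtain rfl := Set.mem_singleton_iff.mp hH
    obtain ⟨g, rfl⟩ := hhH
    exact L.not_isCyclic_stabilizer (hedge.imp id And.left) g
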